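/- Let $0\le a<b$ and consider the Emax model $y=\eta(x,\boldsymbol\theta)+\varepsilon$, $\varepsilon\sim N(0,\sigma^2)$ with $\sigma>0$, where $$\eta(x,\boldsymbol\theta)=\theta_0+\theta_1\frac{x}{x+\theta_2},\qquad x\in[a,b],\quad \boldsymbol\theta=(\theta_0,\theta_1,\theta_2)\in\boldsymbol\Theta .$$ Here $\boldsymbol\Theta\subset\mathbb R^3$ is closed and there are $0<c\le d$ with $\theta_2\in[c,d]$ for all $\boldsymbol\theta\in\boldsymbol\Theta$ (for example, $\boldsymbol\Theta$ compact and contained in $\{\theta_2>0\}$). Let the true parameter $\boldsymbol\theta$ lie in the interior of $\boldsymbol\Theta$ and satisfy $\theta_1\ne0$. Let $\theta_{2,0}>0$ be a guessed value of $\theta_2$ and put $$x^*(\theta_{2,0})=\frac{b(a+\theta_{2,0})+a(b+\theta_{2,0})}{(a+\theta_{2,0})+(b+\theta_{2,0})}.$$ Suppose that $n_1=3k$ independent first-stage observations, $k\ge1$, are taken, $k$ at each of the points $a$, $x^*(\theta_{2,0})$, $b$ (the support of the locally D-optimal design at $\theta_{2,0}$), and let $\hat{\boldsymbol\theta}_{n_1}$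 be a maximum likelihood estimator of $\boldsymbol\theta$, that is, a random vector that almost surely maximizes the likelihood of these observations over $\boldsymbol\Theta$. Then its third component $\hat\theta_{n_1,2}$ is integrable and $$E(\hat\theta_{n_1,2}-\theta_2)=\frac{b_2(\boldsymbol\theta)}{n_1}+O(n_1^{-2}),$$ where the constant in $O(n_1^{-2})$ depends only on $a,b,\sigma,\theta_{2,0},\boldsymbol\theta,\boldsymbol\Theta$, and $$ \begin{aligned} b_2(\boldsymbol\theta)={}&\frac{3\sigma^2(a+\theta_2)^2(b+\theta_2)^2\,[2ab+(a+b)\theta_{2,0}+\theta_2(a+b+2\theta_{2,0})]^2}{(a-b)^4\,\theta_1^2\,\theta_2^2\,(a+\theta_{2,0})^2(b+\theta_{2,0})^2}\\ &\cdot\big[3ab(a+b)+(a^2+10ab+b^2)\theta_{2,0}+3(a+b)\theta_{2,0}^2+2\theta_2\big(a^2+ab+b^2+3(a+b)\theta_{2,0}+3\theta_{2,0}^2\big)\big]>0 . \end{aligned} $$ -/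

import Mathlib

open MeasureTheory ProbabilityTheory
open scoped NNReal

noncomputable section

/-- The Emax mean function `η(x, ϑ) = ϑ₀ + ϑ₁ x / (x + ϑ₂)`. -/
def emaxMean (x : ℝ) (ϑ : Fin 3 → ℝ) : ℝ :=
  ϑ 0 + ϑ 1 * (x / (x + ϑ 2))

/-- The interior support point `x*(t)` of the locally D-optimal design on `[a, b]` for the
value `t` of the nonlinear parameter. -/
def dOptMiddle (a b t : ℝ) : ℝ :=
  (b * (a + t) + a * (b + t)) / ((a + t) + (b + t))

/-- The three support points `a, x*(t), b` of the locally D-optimal design. -/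
def dOptPoint (a b t : ℝ) : Fin 3 → ℝ :=
  ![a, dOptMiddle a b t, b]

/-- Likelihood of `ϑ` given independent observations `y i ∼ N(η(x i, ϑ), σ²)`. -/
def emaxLikelihood {ι : Type*} [Fintype ι] (σ : ℝ≥0) (x y : ι → ℝ) (ϑ : Fin 3 → ℝ) : ℝ :=
  ∏ i, gaussianPDFReal (emaxMean (x i) ϑ) (σ ^ 2) (y i)

/-- `ϑ` is a maximum likelihood estimate, over the parameter set `Θ`, from the observations `y`
taken at the points `x`. -/
def IsEmaxMLE {ι : Type*} [Fintype ι] (Θ : Set (Fin 3 → ℝ)) (σ : ℝ≥0) (x y : ι → ℝ)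
    (ϑ : Fin 3 → ℝ) : Prop :=
  ϑ ∈ Θ ∧ IsMaxOn (emaxLikelihood σ x y) Θ ϑ

/-- The first-order bias coefficient `b₂(θ)`; `t` is the guessed value `θ_{2,0}`. -/
def emaxBiasCoeff (a b t σ : ℝ) (θ : Fin 3 → ℝ) : ℝ :=
  1 / ((a - b) ^ 4 * θ 1 ^ 2 * θ 2 ^ 2 * (a + t) ^ 2 * (b + t) ^ 2) *
    (3 * σ ^ 2 * (a + θ 2) ^ 2 * (b + θ 2) ^ 2 *
      (2 * a * b + (a + b) * t + θ 2 * (a + b + 2 * t)) ^ 2 *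
      (3 * a * b * (a + b) + (a ^ 2 + 10 * a * b + b ^ 2) * t + 3 * (a + b) * t ^ 2 +
        2 * θ 2 * (a ^ 2 + a * b + b ^ 2 + 3 * (a + b) * t + 3 * t ^ 2)))

end

/-! Three design points carry three parameters, so the design is saturated. When the group means of
the errors, `z`, are small, some parameter in `Θ` reproduces the observed group means, and then
every maximum likelihood estimate, being a least squares estimate, does so too
(`IsEmaxMLE.emaxMean_eq`, `exists_forall_emaxMean_eq_add`). Eliminating the two linear parameters
gives the third as a quotient of linear forms in the means, so its error is exactly `L / (D + M)`
with `L`, `M` linear in `z` and `D` a nonzero constant.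

Expand to third order: the linear and cubic terms are odd in Gaussian noise and have mean zero, `-L
* M / D ^ 2` yields the bias, and the remainder is of the order of a fourth moment, that is `(σ ^ 2
/ k) ^ 2`. For large `z` the exact fit may fail, but the error is at most `d - c`, and a bounded
quantity is absorbed by a multiple of the fourth power of `∑ j, |z j|` (`exists_forall_abs_sub_le`);
no tail estimate is needed. -/

/-! ### Least squares and exact fit. -/

/-- A maximum likelihood estimate in the Emax model minimizes the residual sum of squares. -/
lemma IsEmaxMLE.sum_sq_le {ι : Type*} [Fintype ι] {Θ : Set (Fin 3 → ℝ)} {σ : ℝ≥0} (hσ : 0 < σ)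
    {x y : ι → ℝ} {ϑ ϑ' : Fin 3 → ℝ} (h : IsEmaxMLE Θ σ x y ϑ) (hϑ' : ϑ' ∈ Θ) :
    ∑ i, (y i - emaxMean (x i) ϑ) ^ 2 ≤ ∑ i, (y i - emaxMean (x i) ϑ') ^ 2 := by
  have hσ' : (0 : ℝ) < σ := by exact_mod_cast hσ
  have hexp : ∀ ψ, emaxLikelihood σ x y ψ =
      (√(2 * Real.pi * (σ ^ 2 : ℝ≥0)))⁻¹ ^ Fintype.card ι *
        Real.exp (-(∑ i, (y i - emaxMean (x i) ψ) ^ 2) / (2 * (σ : ℝ) ^ 2)) := by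
    intro ψ
    simp only [emaxLikelihood, gaussianPDFReal, Finset.prod_mul_distrib, Finset.prod_const,
      Finset.card_univ, ← Real.exp_sum]
    congr 2
    rw [← Finset.sum_div, Finset.sum_neg_distrib]
    simp
  have h1 := h.2 hϑ'
  simp only [Set.mem_ofPred_eq, hexp] at h1
  have hpos : 0 < (√(2 * Real.pi * (σ ^ 2 : ℝ≥0)))⁻¹ ^ Fintype.card ι := by
    have := Real.pi_pos
    have : 0 < 2 * Real.pi * (σ ^ 2 : ℝ≥0) := by push_cast; positivity
    positivity
  have h2 := Real.exp_le_exp.1 (le_of_mul_le_mul_left h1 hpos)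
  rw [div_le_div_iff_of_pos_right (by positivity)] at h2
  linarith

/-- The sum of squared deviations from `u` splits into the part around `m + (mean of e)` and the
squared distance between `u` and that point. -/
lemma sum_sq_sub_eq {k : ℕ} (hk : 0 < k) (m u : ℝ) (e : Fin k → ℝ) :
    ∑ l, (m + e l - u) ^ 2 =
      ∑ l, (m + e l - (m + (∑ l, e l) / k)) ^ 2 + k * (m + (∑ l, e l) / k - u) ^ 2 := by
  have hk' : (k : ℝ) ≠ 0 := by positivity
  set s := (∑ l, e l) / k with hs
  have hsum : ∑ l, e l = k * s := by rw [hs]; field_simp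
  have : ∀ l, (m + e l - u) ^ 2 =
      (m + e l - (m + s)) ^ 2 + ((m + s - u) ^ 2 + 2 * (m + s - u) * e l
        - 2 * (m + s - u) * s) := fun l => by ring
  simp_rw [this]
  rw [Finset.sum_add_distrib, Finset.sum_sub_distrib, Finset.sum_add_distrib, ← Finset.mul_sum, hsum]
  simp
  ring

/-- If some parameter fits the group means exactly, so does every maximum likelihood estimate. -/
lemma IsEmaxMLE.emaxMean_eq {k : ℕ} (hk : 0 < k) {Θ : Set (Fin 3 → ℝ)} {σ : ℝ≥0} (hσ : 0 < σ)
    {x μ : Fin 3 → ℝ} {e : Fin 3 × Fin k → ℝ} {ϑ ϑ' : Fin 3 → ℝ}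
    (h : IsEmaxMLE Θ σ (fun i : Fin 3 × Fin k => x i.1) (fun i => μ i.1 + e i) ϑ)
    (hϑ' : ϑ' ∈ Θ) (hfit : ∀ j, emaxMean (x j) ϑ' = μ j + (∑ l, e (j, l)) / k) (j : Fin 3) :
    emaxMean (x j) ϑ = μ j + (∑ l, e (j, l)) / k := by
  have hk' : (0 : ℝ) < k := by positivity
  have h1 := h.sum_sq_le hσ hϑ'
  simp only [Fintype.sum_prod_type] at h1
  -- The within-group part is independent of `ψ`, so only the distance to the group means is being
  -- minimized.
  have h2 : ∀ ψ : Fin 3 → ℝ, ∑ j, ∑ l, (μ j + e (j, l) - emaxMean (x j) ψ) ^ 2 =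
      ∑ j, ∑ l, (μ j + e (j, l) - (μ j + (∑ l, e (j, l)) / k)) ^ 2 +
        k * ∑ j, (μ j + (∑ l, e (j, l)) / k - emaxMean (x j) ψ) ^ 2 := by
    intro ψ
    rw [Finset.mul_sum, ← Finset.sum_add_distrib]
    exact Finset.sum_congr rfl fun j _ => sum_sq_sub_eq hk _ _ fun l => e (j, l)
  rw [h2, h2] at h1
  have h3 : ∑ j, (μ j + (∑ l, e (j, l)) / k - emaxMean (x j) ϑ) ^ 2 ≤ 0 := by
    have h4 : ∑ j, (μ j + (∑ l, e (j, l)) / k - emaxMean (x j) ϑ') ^ 2 = 0 :=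
      Finset.sum_eq_zero fun j _ => by rw [hfit]; ring
    rw [h4] at h1
    nlinarith
  have h5 := (Finset.sum_eq_zero_iff_of_nonneg (fun j _ => sq_nonneg _)).1
    (le_antisymm h3 (Finset.sum_nonneg fun j _ => sq_nonneg _)) j (Finset.mem_univ j)
  have := pow_eq_zero_iff (two_ne_zero) |>.1 h5
  linarith

/-! ### Inverting the mean function at three points. -/

/-- The denominator in the rational expression for the nonlinear Emax parameter in terms of the
values of the mean function at `a`, `m`, `b`. -/
def emaxDen (a m b : ℝ) (y : Fin 3 → ℝ) : ℝ := (b - a) * (y 1 - y 0) - (m - a) * (y 2 - y 0)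

/-- The numerator in the rational expression for the nonlinear Emax parameter in terms of the
values of the mean function at `a`, `m`, `b`. -/
def emaxNum (a m b : ℝ) (y : Fin 3 → ℝ) : ℝ :=
  (m - a) * b * (y 2 - y 0) - (b - a) * m * (y 1 - y 0)

lemma emaxDen_add (a m b : ℝ) (y z : Fin 3 → ℝ) :
    emaxDen a m b (fun j => y j + z j) = emaxDen a m b y + emaxDen a m b z := by
  simp only [emaxDen]; ring

lemma emaxNum_add (a m b : ℝ) (y z : Fin 3 → ℝ) :
    emaxNum a m b (fun j => y j + z j) = emaxNum a m b y + emaxNum a m b z := by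
  simp only [emaxNum]; ring

/-- The differences `y 1 - y 0` and `y 2 - y 0` share the factor `ϑ 1 * ϑ 2 / (a + ϑ 2)`.
Cross-multiplying removes it and leaves an equation linear in `ϑ 2`. Without division it also covers
`emaxDen = 0`. -/
lemma mul_emaxDen_eq_emaxNum {a m b : ℝ} {ϑ y : Fin 3 → ℝ} (ha : a + ϑ 2 ≠ 0) (hm : m + ϑ 2 ≠ 0)
    (hb : b + ϑ 2 ≠ 0) (hy : ∀ j, emaxMean (![a, m, b] j) ϑ = y j) :
    ϑ 2 * emaxDen a m b y = emaxNum a m b y := by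
  have h0 := hy 0
  have h1 := hy 1
  have h2 := hy 2
  simp only [emaxMean, Matrix.cons_val] at h0 h1 h2
  simp only [emaxDen, emaxNum, ← h0, ← h1, ← h2]
  field_simp
  ring

/-- `emaxDen` is `b - a` times the height of the middle value above the chord; it measures the
curvature of the mean function, which is lost only if `θ 1 * θ 2 = 0`. -/
lemma emaxDen_emaxMean {a m b : ℝ} {θ : Fin 3 → ℝ} (ha : a + θ 2 ≠ 0) (hm : m + θ 2 ≠ 0)
    (hb : b + θ 2 ≠ 0) :
    emaxDen a m b (fun j => emaxMean (![a, m, b] j) θ) =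
      θ 1 * θ 2 * (b - a) * (m - a) * (b - m) / ((a + θ 2) * (m + θ 2) * (b + θ 2)) := by
  simp only [emaxDen, emaxMean, Matrix.cons_val]
  field_simp
  ring

lemma emaxDen_emaxMean_ne_zero {a m b : ℝ} (ha : 0 ≤ a) (ham : a < m) (hmb : m < b)
    {θ : Fin 3 → ℝ} (h1 : θ 1 ≠ 0) (h2 : 0 < θ 2) :
    (emaxDen a m b fun j => emaxMean (![a, m, b] j) θ) ≠ 0 := by
  have hm0 : 0 < m + θ 2 := by linarith
  have hb0 : 0 < b + θ 2 := by linarith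
  rw [emaxDen_emaxMean (by positivity) hm0.ne' hb0.ne']
  have : 0 < m - a := by linarith
  have : 0 < b - m := by linarith
  have : 0 < b - a := by linarith
  positivity

/-- Solving the three equations `emaxMean x ϑ = y` at the points `a`, `m`, `b` for `ϑ`. -/
noncomputable def emaxSolve (a m b : ℝ) (y : Fin 3 → ℝ) : Fin 3 → ℝ :=
  let h := emaxNum a m b y / emaxDen a m b y
  let s := (y 2 - y 0) * (a + h) * (b + h) / (h * (b - a))
  ![y 0 - s * (a / (a + h)), s, h]

lemma emaxMean_emaxSolve {a m b : ℝ} (ha : 0 ≤ a) (ham : a < m) (hmb : m < b) {y : Fin 3 → ℝ}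
    (hD : emaxDen a m b y ≠ 0) (hpos : 0 < emaxSolve a m b y 2) (j : Fin 3) :
    emaxMean (![a, m, b] j) (emaxSolve a m b y) = y j := by
  simp only [emaxSolve, Matrix.cons_val] at hpos
  have hh : emaxNum a m b y / emaxDen a m b y * emaxDen a m b y = emaxNum a m b y :=
    div_mul_cancel₀ _ hD
  simp only [emaxMean, emaxSolve, Matrix.cons_val]
  generalize emaxNum a m b y / emaxDen a m b y = h at hh hpos ⊢
  have h1 : a + h ≠ 0 := by positivity
  have h2 : m + h ≠ 0 := by linarith
  have h3 : b + h ≠ 0 := by linarith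
  have h4 : b - a ≠ 0 := by linarith
  have h5 := hpos.ne'
  simp only [emaxNum, emaxDen] at hh
  -- The intercept settles the equation at `a` and the slope the one at `b`; only the equation at
  -- `m` needs the choice of `h`, through `hh`.
  fin_cases j
  · simp
  · simp only [Fin.mk_one, Matrix.cons_val]
    field_simp
    linear_combination -h * hh
  · simp only [Fin.reduceFinMk, Matrix.cons_val]
    field_simp
    ring

lemma emaxSolve_emaxMean {a m b : ℝ} (ha : 0 ≤ a) (ham : a < m) (hmb : m < b) {θ : Fin 3 → ℝ}
    (h1 : θ 1 ≠ 0) (h2 : 0 < θ 2) :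
    emaxSolve a m b (fun j => emaxMean (![a, m, b] j) θ) = θ := by
  have ha' : a + θ 2 ≠ 0 := by positivity
  have hm' : m + θ 2 ≠ 0 := by linarith
  have hb' : b + θ 2 ≠ 0 := by linarith
  have hba : b - a ≠ 0 := by linarith
  have hD := emaxDen_emaxMean_ne_zero ha ham hmb h1 h2
  have hN : emaxNum a m b (fun j => emaxMean (![a, m, b] j) θ) /
      emaxDen a m b (fun j => emaxMean (![a, m, b] j) θ) = θ 2 := by
    rw [div_eq_iff hD, mul_emaxDen_eq_emaxNum ha' hm' hb' fun j => rfl]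
  have h2' := h2.ne'
  have hs : (emaxMean b θ - emaxMean a θ) * (a + θ 2) * (b + θ 2) / (θ 2 * (b - a)) = θ 1 := by
    simp only [emaxMean]
    field_simp
    ring
  ext j
  simp only [emaxSolve, hN, Matrix.cons_val, hs]
  fin_cases j <;> simp [emaxMean]

/-- Near a regular parameter in the interior of `Θ` the three equations are solvable in `Θ`. -/
lemma exists_forall_emaxMean_eq_add {a m b : ℝ} (ha : 0 ≤ a) (ham : a < m) (hmb : m < b)
    {Θ : Set (Fin 3 → ℝ)} {θ : Fin 3 → ℝ} (hθ : θ ∈ interior Θ) (h1 : θ 1 ≠ 0) (h2 : 0 < θ 2) :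
    ∃ δ > 0, ∀ z : Fin 3 → ℝ, (∀ j, |z j| < δ) →
      ∃ ϑ ∈ Θ, ∀ j, emaxMean (![a, m, b] j) ϑ = emaxMean (![a, m, b] j) θ + z j := by
  have ha' : a + θ 2 ≠ 0 := by positivity
  have hm' : m + θ 2 ≠ 0 := by linarith
  have hb' : b + θ 2 ≠ 0 := by linarith
  have hba : b - a ≠ 0 := by linarith
  set y₀ : Fin 3 → ℝ := fun j => emaxMean (![a, m, b] j) θ with hy₀
  have hsol : emaxSolve a m b y₀ = θ := emaxSolve_emaxMean ha ham hmb h1 h2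
  have hD : emaxDen a m b y₀ ≠ 0 := emaxDen_emaxMean_ne_zero ha ham hmb h1 h2
  have hcD : Continuous (emaxDen a m b) := by unfold emaxDen; fun_prop
  have hcN : Continuous (emaxNum a m b) := by unfold emaxNum; fun_prop
  have hh : emaxNum a m b y₀ / emaxDen a m b y₀ = θ 2 := by
    simpa [emaxSolve] using congrFun hsol 2
  have hch : ContinuousAt (fun y => emaxNum a m b y / emaxDen a m b y) y₀ :=
    hcN.continuousAt.div hcD.continuousAt hD
  have hcs : ContinuousAt (fun y : Fin 3 → ℝ => (y 2 - y 0) *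
      (a + emaxNum a m b y / emaxDen a m b y) * (b + emaxNum a m b y / emaxDen a m b y) /
        (emaxNum a m b y / emaxDen a m b y * (b - a))) y₀ := by
    refine ContinuousAt.div (by fun_prop) (by fun_prop) ?_
    rw [hh]; exact mul_ne_zero h2.ne' hba
  have hcsol : ContinuousAt (emaxSolve a m b) y₀ := by
    rw [continuousAt_pi]
    intro j
    fin_cases j
    · have : ContinuousAt (fun y => a / (a + emaxNum a m b y / emaxDen a m b y)) y₀ :=
        ContinuousAt.div (by fun_prop) (by fun_prop) (by rw [hh]; exact ha')
      exact (continuous_apply (0 : Fin 3)).continuousAt.sub (hcs.mul this)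
    · simpa [emaxSolve] using hcs
    · simpa [emaxSolve] using hch
  have hev1 : ∀ᶠ y in nhds y₀, emaxSolve a m b y ∈ Θ := by
    apply hcsol.eventually_mem
    rw [hsol]; exact mem_interior_iff_mem_nhds.1 hθ
  have hev2 : ∀ᶠ y in nhds y₀, 0 < emaxSolve a m b y 2 := by
    have : ContinuousAt (fun y => emaxSolve a m b y 2) y₀ :=
      (continuous_apply (2 : Fin 3)).continuousAt.comp hcsol
    apply this.eventually_const_lt
    simpa only [hsol] using h2
  have hev3 : ∀ᶠ y in nhds y₀, emaxDen a m b y ≠ 0 := hcD.continuousAt.eventually_ne hD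
  obtain ⟨δ, hδ, hball⟩ := Metric.eventually_nhds_iff.1 (hev1.and (hev2.and hev3))
  refine ⟨δ, hδ, fun z hz => ?_⟩
  have hdist : dist (fun j => y₀ j + z j) y₀ < δ := by
    rw [dist_pi_lt_iff hδ]
    intro j
    simpa [Real.dist_eq] using hz j
  obtain ⟨k1, k2, k3⟩ := hball hdist
  exact ⟨_, k1, fun j => emaxMean_emaxSolve ha ham hmb k3 k2 j⟩

/-! ### Cubic expansion with a uniform remainder. -/

/-- A quotient `L / (D + M)` is approximated by its cubic Taylor polynomial, uniformly also over
the region where only a bound for `T` is available. -/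
lemma exists_forall_abs_sub_le {D A B δ : ℝ} (hD : D ≠ 0) (hA : 0 ≤ A) (hB : 0 ≤ B) (hδ : 0 < δ) :
    ∃ C, 0 ≤ C ∧ ∀ T L M s : ℝ, 0 ≤ s → |L| ≤ A * s → |M| ≤ A * s → |T| ≤ B →
      (s < δ → T * (D + M) = L) →
      |T - (L / D - L * M / D ^ 2 + L * M ^ 2 / D ^ 3)| ≤ C * s ^ 4 := by
  have hD' : 0 < |D| := abs_pos.2 hD
  -- Below `ρ` the equation for `T` holds and `|M| ≤ |D| / 2`; the `+ 1` keeps the denominator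
  -- positive when `A = 0`.
  set ρ := min δ (|D| / (2 * (A + 1))) with hρ
  have hρ0 : 0 < ρ := lt_min hδ (by positivity)
  -- The first summand serves `s < ρ`; the other four bound `T` and the three Taylor terms when `ρ ≤
  -- s`.
  refine ⟨2 * A ^ 4 / |D| ^ 4 + (B / ρ ^ 4 + A / |D| / ρ ^ 3 + A * A / |D| ^ 2 / ρ ^ 2 +
    A * A ^ 2 / |D| ^ 3 / ρ), by positivity, ?_⟩
  intro T L M s hs hL hM hT hTL
  rw [add_mul]
  by_cases hsρ : s < ρ
  · have hTL' := hTL (hsρ.trans_le (min_le_left _ _))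
    have hM2 : |M| ≤ |D| / 2 := by
      have h1 : s * (2 * (A + 1)) < |D| := by
        rw [← lt_div_iff₀ (by positivity)]; exact hsρ.trans_le (min_le_right _ _)
      nlinarith
    have hDM : |D| / 2 ≤ |D + M| := by
      have h := abs_add_le (D + M) (-M)
      rw [add_neg_cancel_right, abs_neg] at h
      linarith
    -- Finite geometric series: the Taylor polynomial times `D + M` is `L * (1 + M ^ 3 / D ^ 3)`.
    have key : (T - (L / D - L * M / D ^ 2 + L * M ^ 2 / D ^ 3)) * (D + M) = -(L * M ^ 3 / D ^ 3) := by
      rw [sub_mul, hTL']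
      field_simp
      ring
    have habs := congrArg abs key
    rw [abs_mul, abs_neg, abs_div, abs_mul, abs_pow, abs_pow] at habs
    set R := |T - (L / D - L * M / D ^ 2 + L * M ^ 2 / D ^ 3)|
    have hR : 0 ≤ R := abs_nonneg _
    have h1 : |L| * |M| ^ 3 ≤ (A * s) * (A * s) ^ 3 := by gcongr
    have h2 : R * (|D| / 2) ≤ (A * s) * (A * s) ^ 3 / |D| ^ 3 :=
      calc R * (|D| / 2) ≤ R * |D + M| := by gcongr
        _ = |L| * |M| ^ 3 / |D| ^ 3 := habs
        _ ≤ _ := by gcongr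
    have h3 : R ≤ 2 * A ^ 4 / |D| ^ 4 * s ^ 4 := by
      calc R = R * (|D| / 2) * (2 / |D|) := by field_simp
        _ ≤ (A * s) * (A * s) ^ 3 / |D| ^ 3 * (2 / |D|) := by gcongr
        _ = _ := by field_simp
    exact le_add_of_le_of_nonneg h3 (by positivity)
  · push Not at hsρ
    refine le_add_of_nonneg_of_le (by positivity) ?_
    have hs0 : 0 < s := hρ0.trans_le hsρ
    -- As `1 ≤ s / ρ`, missing powers of `s` can be supplied at the cost of powers of `ρ`.
    have hpow : ∀ n : ℕ, ∀ c : ℝ, 0 ≤ c → c ≤ c / ρ ^ n * s ^ n := by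
      intro n c hc
      rw [div_mul_eq_mul_div, le_div_iff₀ (by positivity)]
      gcongr
    have e1 : |L / D| ≤ A / |D| / ρ ^ 3 * s ^ 4 := by
      rw [abs_div]
      calc |L| / |D| ≤ A * s / |D| := by gcongr
        _ = A / |D| * s := by ring
        _ ≤ A / |D| / ρ ^ 3 * s ^ 3 * s := by gcongr; exact hpow 3 _ (by positivity)
        _ = _ := by ring
    have e2 : |L * M / D ^ 2| ≤ A * A / |D| ^ 2 / ρ ^ 2 * s ^ 4 := by
      rw [abs_div, abs_mul, abs_pow]
      calc |L| * |M| / |D| ^ 2 ≤ (A * s) * (A * s) / |D| ^ 2 := by gcongr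
        _ = A * A / |D| ^ 2 * s ^ 2 := by ring
        _ ≤ A * A / |D| ^ 2 / ρ ^ 2 * s ^ 2 * s ^ 2 := by gcongr; exact hpow 2 _ (by positivity)
        _ = _ := by ring
    have e3 : |L * M ^ 2 / D ^ 3| ≤ A * A ^ 2 / |D| ^ 3 / ρ * s ^ 4 := by
      rw [abs_div, abs_mul, abs_pow, abs_pow]
      calc |L| * |M| ^ 2 / |D| ^ 3 ≤ (A * s) * (A * s) ^ 2 / |D| ^ 3 := by gcongr
        _ = A * A ^ 2 / |D| ^ 3 * s ^ 3 := by ring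
        _ ≤ A * A ^ 2 / |D| ^ 3 / ρ ^ 1 * s ^ 1 * s ^ 3 := by
          gcongr; exact hpow 1 _ (by positivity)
        _ = _ := by ring
    have e0 : |T| ≤ B / ρ ^ 4 * s ^ 4 := hT.trans (hpow 4 B hB)
    have := abs_sub T (L / D - L * M / D ^ 2 + L * M ^ 2 / D ^ 3)
    have := abs_add_le (L / D - L * M / D ^ 2) (L * M ^ 2 / D ^ 3)
    have := abs_sub (L / D) (L * M / D ^ 2)
    linarith

/-! ### Gaussian moments of group means. -/

section Moments

variable {Ω : Type*} [MeasurableSpace Ω] {P : Measure Ω}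

/-- Odd functions of independent centred Gaussian variables have mean zero. -/
lemma integral_eq_zero_of_odd_of_gaussian {ι : Type*} [Fintype ι] [IsProbabilityMeasure P]
    {X : ι → Ω → ℝ} {v : ℝ≥0} (hind : iIndepFun X P) (hX : ∀ i, HasLaw (X i) (gaussianReal 0 v) P)
    {f : (ι → ℝ) → ℝ} (hf : Continuous f) (hodd : ∀ x, f (-x) = -f x) :
    ∫ ω, f (fun i => X i ω) ∂P = 0 := by
  have hlaw := hind.hasLaw_pi hX
  have h1 : ∫ ω, f (fun i => X i ω) ∂P = ∫ x, f x ∂Measure.pi fun _ : ι => gaussianReal 0 v :=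
    hlaw.integral_comp hf.aestronglyMeasurable
  have : (gaussianReal 0 v).IsNegInvariant := ⟨by
    simpa [Measure.neg, Function.comp_def] using gaussianReal_map_neg (μ := 0) (v := v)⟩
  have h2 := integral_neg_eq_self f (Measure.pi fun _ : ι => gaussianReal 0 v)
  simp_rw [hodd, integral_neg] at h2
  rw [h1]
  linarith

/-- The mean of `k` independent `N(0, v)` variables is `N(0, v / k)`. -/
lemma hasLaw_mean_gaussianReal {k : ℕ} (hk : 0 < k) [IsProbabilityMeasure P] {X : Fin k → Ω → ℝ}
    {v : ℝ≥0} (hind : iIndepFun X P) (hX : ∀ i, HasLaw (X i) (gaussianReal 0 v) P) :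
    HasLaw (fun ω => (∑ l, X l ω) / k) (gaussianReal 0 (v / k)) P := by
  have hG : HasGaussianLaw (fun ω => ∑ l, X l ω) P :=
    hind.hasGaussianLaw_fun_sum fun i => (hX i).hasGaussianLaw
  have hmean : ∫ ω, ∑ l, X l ω ∂P = 0 := by
    rw [integral_finsetSum _ fun i _ => (hX i).hasGaussianLaw.integrable]
    refine Finset.sum_eq_zero fun i _ => ?_
    rw [(hX i).integral_eq, integral_id_gaussianReal]
  have hvar : Var[fun ω => ∑ l, X l ω; P] = k * v := by
    have := IndepFun.variance_sum (s := Finset.univ) (X := X) (μ := P)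
      (fun i _ => (hX i).hasGaussianLaw.memLp_two) (fun i _ j _ hij => hind.indepFun hij)
    rw [Finset.sum_fn] at this
    rw [this]
    simp [(hX _).variance_eq]
  have hlaw : HasLaw (fun ω => ∑ l, X l ω) (gaussianReal 0 (k * v)) P := by
    refine ⟨hG.aemeasurable, ?_⟩
    rw [hG.map_eq_gaussianReal, hmean, hvar]
    congr
    rw [← NNReal.coe_natCast, ← NNReal.coe_mul, Real.toNNReal_coe]
  have hk' : (k : ℝ≥0) ≠ 0 := by exact_mod_cast hk.ne'
  convert gaussianReal_div_const hlaw (k : ℝ) using 2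
  · simp
  · ext
    simp
    field_simp

/-- The fourth moment of a centred Gaussian variable, as a multiple of the squared variance. -/
lemma integral_pow_four_of_gaussian {X : Ω → ℝ} {v : ℝ≥0} (hX : HasLaw X (gaussianReal 0 v) P) :
    ∫ ω, X ω ^ 4 ∂P = v ^ 2 * ∫ x, x ^ 4 ∂gaussianReal 0 1 := by
  have h1 : ∫ ω, X ω ^ 4 ∂P = ∫ x, x ^ 4 ∂gaussianReal 0 v :=
    hX.integral_comp (f := fun x => x ^ 4) (by fun_prop)
  have h2 := gaussianReal_map_const_mul (μ := 0) (v := 1) (√v)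
  have h3 : gaussianReal 0 v = (gaussianReal 0 1).map (√v * ·) := by
    rw [h2, mul_zero]
    congr
    ext
    simp
  rw [h1, h3, integral_map (by fun_prop) (by fun_prop), ← integral_const_mul]
  congr with x
  have : √(v : ℝ) ^ 4 = (v : ℝ) ^ 2 := by
    rw [show (4 : ℕ) = 2 * 2 from rfl, pow_mul, Real.sq_sqrt v.coe_nonneg]
  rw [mul_pow, this]

/-- Means over distinct groups of an independent family are independent. -/
lemma indepFun_group_mean {κ : Type*} [Fintype κ] {k : ℕ} {X : κ × Fin k → Ω → ℝ}
    (hind : iIndepFun X P) (hX : ∀ i, AEMeasurable (X i) P) {i j : κ} (hij : i ≠ j) :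
    IndepFun (fun ω => (∑ l, X (i, l) ω) / k) (fun ω => (∑ l, X (j, l) ω) / k) P := by
  classical
  obtain ⟨S, hmem, hdisj⟩ : ∃ S : κ → Finset (κ × Fin k), (∀ i l, (i, l) ∈ S i) ∧
      ∀ i j, i ≠ j → Disjoint (S i) (S j) := by
    refine ⟨fun i => Finset.univ.filter fun p => p.1 = i, fun i l => by simp, fun i j hij => ?_⟩
    rw [Finset.disjoint_left]
    intro p h1 h2
    exact hij ((Finset.mem_filter.1 h1).2.symm.trans (Finset.mem_filter.1 h2).2)
  have hφ : ∀ i, Measurable fun x : S i → ℝ => (∑ l, x ⟨(i, l), hmem i l⟩) / (k : ℝ) :=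
    fun i => by fun_prop
  exact (hind.indepFun_finset₀ (S i) (S j) (hdisj i j hij) hX).comp (hφ i) (hφ j)

/-- Second mixed moments of the group means of an independent Gaussian family. -/
lemma integral_group_mean_mul {κ : Type*} [Fintype κ] [DecidableEq κ] {k : ℕ} (hk : 0 < k)
    [IsProbabilityMeasure P] {X : κ × Fin k → Ω → ℝ} {v : ℝ≥0} (hind : iIndepFun X P)
    (hX : ∀ i, HasLaw (X i) (gaussianReal 0 v) P) (i j : κ) :
    ∫ ω, (∑ l, X (i, l) ω) / k * ((∑ l, X (j, l) ω) / k) ∂P = if i = j then (v / k : ℝ) else 0 := by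
  have hlaw : ∀ i, HasLaw (fun ω => (∑ l, X (i, l) ω) / k) (gaussianReal 0 (v / k)) P := fun i =>
    hasLaw_mean_gaussianReal hk (hind.precomp (Prod.mk_right_injective i)) fun l => hX (i, l)
  have hmean : ∀ i, ∫ ω, (∑ l, X (i, l) ω) / k ∂P = 0 := fun i => by
    rw [(hlaw i).integral_eq, integral_id_gaussianReal]
  split_ifs with hij
  · subst hij
    have h1 := (hlaw i).variance_eq
    rw [variance_id_gaussianReal, variance_of_integral_eq_zero (hlaw i).aemeasurable (hmean i)] at h1
    simp_rw [← sq]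
    simpa using h1
  · rw [(indepFun_group_mean hind (fun i => (hX i).aemeasurable) hij).integral_fun_mul_eq_mul_integral
      (hlaw i).aemeasurable.aestronglyMeasurable (hlaw j).aemeasurable.aestronglyMeasurable,
      hmean, zero_mul]

end Moments

/-! ### Expectation of the cubic expansion. -/

section Expansion

variable {Ω : Type*} [MeasurableSpace Ω] {P : Measure Ω}

/-- If `T` agrees with the cubic expansion of `L / (D + M)` up to fourth order, where `L` and `M` are
linear forms in the group means of an independent Gaussian family, then its mean is determined by
the covariance of `L` and `M` up to an error of second order in the variance of the means. -/
lemma abs_integral_add_le_of_cubic_expansion {κ : Type*} [Fintype κ] [Nonempty κ] {k : ℕ}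
    (hk : 0 < k) [IsProbabilityMeasure P] {X : κ × Fin k → Ω → ℝ} {v : ℝ≥0}
    (hind : iIndepFun X P) (hX : ∀ i, HasLaw (X i) (gaussianReal 0 v) P) (ℓ w : κ → ℝ) (D : ℝ)
    {C : ℝ} (hC : 0 ≤ C) {T : Ω → ℝ} (hT : Integrable T P)
    (hTF : ∀ᵐ ω ∂P, ∀ L M : ℝ, L = ∑ j, ℓ j * ((∑ l, X (j, l) ω) / k) →
      M = ∑ j, w j * ((∑ l, X (j, l) ω) / k) →
      |T ω - (L / D - L * M / D ^ 2 + L * M ^ 2 / D ^ 3)| ≤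
        C * (∑ j, |(∑ l, X (j, l) ω) / k|) ^ 4) :
    |(∫ ω, T ω ∂P) + v / k * (∑ j, ℓ j * w j) / D ^ 2| ≤
      C * Fintype.card κ ^ 4 * (∫ x, x ^ 4 ∂gaussianReal 0 1) * (v / k) ^ 2 := by
  classical
  set z : κ → Ω → ℝ := fun j ω => (∑ l, X (j, l) ω) / k with hz
  have hlaw : ∀ j, HasLaw (z j) (gaussianReal 0 (v / k)) P := fun j =>
    hasLaw_mean_gaussianReal hk (hind.precomp (Prod.mk_right_injective j)) fun l => hX (j, l)
  have hmem : ∀ (p : ENNReal), p ≠ ⊤ → ∀ j, MemLp (z j) p P := fun p hp j =>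
    (hlaw j).hasGaussianLaw.memLp hp
  set L : Ω → ℝ := fun ω => ∑ j, ℓ j * z j ω with hL
  set M : Ω → ℝ := fun ω => ∑ j, w j * z j ω with hM
  have hLm : ∀ (p : ENNReal), p ≠ ⊤ → MemLp L p P := fun p hp =>
    memLp_finsetSum _ fun j _ => (hmem p hp j).const_mul _
  have hMm : ∀ (p : ENNReal), p ≠ ⊤ → MemLp M p P := fun p hp =>
    memLp_finsetSum _ fun j _ => (hmem p hp j).const_mul _
  have hLi : Integrable L P := (hLm 1 (by simp)).integrable le_rfl
  have hLMi : Integrable (fun ω => L ω * M ω) P :=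
    (hLm 2 (by simp)).integrable_mul (hMm 2 (by simp))
  have hM4 : Integrable (fun ω => M ω ^ 4) P := by
    simpa [Even.pow_abs (show Even 4 by decide)] using (hMm 4 (by simp)).integrable_norm_pow (p := 4) (by simp)
  -- Dominated by `L ^ 2 + M ^ 4`.
  have hLMMi : Integrable (fun ω => L ω * M ω ^ 2) P := by
    refine ((hLm 2 (by simp)).integrable_sq.add hM4).mono'
      (hLi.1.mul ((hMm 1 (by simp)).1.pow 2)) (Filter.Eventually.of_forall fun ω => ?_)
    rw [Real.norm_eq_abs, abs_le, Pi.add_apply]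
    constructor <;> nlinarith [sq_nonneg (L ω + M ω ^ 2), sq_nonneg (L ω - M ω ^ 2)]
  -- Stopping the expansion before the cubic term would leave an error of order `(v / k) ^ (3 / 2)`;
  -- the oddness of that term gains the missing half power.
  have hodd : ∀ f : (κ × Fin k → ℝ) → ℝ, Continuous f → (∀ x, f (-x) = -f x) →
      ∫ ω, f (fun i => X i ω) ∂P = 0 := fun f hf h =>
    integral_eq_zero_of_odd_of_gaussian hind hX hf h
  have hneg : ∀ (u : κ → ℝ) (x : κ × Fin k → ℝ), ∑ j, u j * ((∑ l, (-x) (j, l)) / k) =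
      -∑ j, u j * ((∑ l, x (j, l)) / k) := by
    intro u x
    simp [Finset.sum_neg_distrib, neg_div]
  have hL0 : ∫ ω, L ω ∂P = 0 :=
    hodd (fun x => ∑ j, ℓ j * ((∑ l, x (j, l)) / k)) (by fun_prop) (hneg ℓ)
  have hLMM0 : ∫ ω, L ω * M ω ^ 2 ∂P = 0 :=
    hodd (fun x => (∑ j, ℓ j * ((∑ l, x (j, l)) / k)) * (∑ j, w j * ((∑ l, x (j, l)) / k)) ^ 2)
      (by fun_prop) fun x => by rw [hneg, hneg]; ring
  have hLM : ∫ ω, L ω * M ω ∂P = v / k * ∑ j, ℓ j * w j := by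
    have h1 : ∀ ω, L ω * M ω = ∑ i, ∑ j, ℓ i * w j * (z i ω * z j ω) := by
      intro ω
      simp only [hL, hM, Finset.sum_mul_sum]
      exact Finset.sum_congr rfl fun i _ => Finset.sum_congr rfl fun j _ => by ring
    have hint : ∀ i j, Integrable (fun ω => ℓ i * w j * (z i ω * z j ω)) P := fun i j =>
      ((hmem 2 (by simp) i).integrable_mul (hmem 2 (by simp) j)).const_mul _
    simp_rw [h1]
    rw [integral_finsetSum _ fun i _ => integrable_finsetSum _ fun j _ => hint i j]
    simp_rw [integral_finsetSum _ fun j _ => hint _ j, integral_const_mul]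
    simp only [hz, integral_group_mean_mul hk hind hX]
    simp [Finset.mul_sum, mul_comm]
  set F : Ω → ℝ := fun ω => L ω / D - L ω * M ω / D ^ 2 + L ω * M ω ^ 2 / D ^ 3 with hF
  have h12 : Integrable (fun ω => L ω / D - L ω * M ω / D ^ 2) P :=
    (hLi.div_const D).sub (hLMi.div_const (D ^ 2))
  have hFi : Integrable F P := h12.add (hLMMi.div_const (D ^ 3))
  have hFint : ∫ ω, F ω ∂P = -(v / k * (∑ j, ℓ j * w j) / D ^ 2) := by
    simp only [hF]
    rw [integral_add h12 (hLMMi.div_const (D ^ 3)),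
      integral_sub (hLi.div_const D) (hLMi.div_const (D ^ 2)), integral_div, integral_div,
      integral_div, hL0, hLMM0, hLM]
    ring
  have hz4i : ∀ j, Integrable (fun ω => z j ω ^ 4) P := fun j => by
    simpa [Even.pow_abs (show Even 4 by decide)] using (hmem 4 (by simp) j).integrable_norm_pow (p := 4) (by simp)
  have hbound : ∀ᵐ ω ∂P, ‖T ω - F ω‖ ≤ C * Fintype.card κ ^ 3 * ∑ j, z j ω ^ 4 := by
    filter_upwards [hTF] with ω hω
    refine (hω _ _ rfl rfl).trans ?_
    rw [mul_assoc]
    gcongr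
    -- Power mean inequality, giving the factor `card ^ 3`; summing equal fourth moments adds one
    -- more `card`.
    have h := pow_sum_div_card_le_sum_pow (s := Finset.univ) (f := fun j => |z j ω|)
      (fun j _ => abs_nonneg _) 3
    simpa [div_le_iff₀', pow_pos, Fintype.card_pos, Even.pow_abs (show Even 4 by decide)] using h
  have hfin := norm_integral_le_of_norm_le
    ((integrable_finsetSum _ fun j _ => hz4i j).const_mul (C * (Fintype.card κ : ℝ) ^ 3)) hbound
  rw [integral_sub hT hFi, hFint, sub_neg_eq_add, Real.norm_eq_abs, integral_const_mul,
    integral_finsetSum _ fun j _ => hz4i j] at hfin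
  simp_rw [integral_pow_four_of_gaussian (hlaw _)] at hfin
  refine hfin.trans_eq ?_
  simp
  ring

end Expansion

/-! ### Closed form of the bias coefficient. -/

lemma dOptMiddle_sub_left {a b t : ℝ} (ha : 0 ≤ a) (hab : a < b) (ht : 0 < t) :
    dOptMiddle a b t - a = (b - a) * (a + t) / (a + b + 2 * t) := by
  have h2 : a + b + 2 * t ≠ 0 := by linarith
  rw [dOptMiddle, show a + t + (b + t) = a + b + 2 * t by ring, eq_div_iff h2, sub_mul,
    div_mul_cancel₀ _ h2]
  ring

lemma sub_dOptMiddle {a b t : ℝ} (ha : 0 ≤ a) (hab : a < b) (ht : 0 < t) :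
    b - dOptMiddle a b t = (b - a) * (b + t) / (a + b + 2 * t) := by
  have h2 : a + b + 2 * t ≠ 0 := by linarith
  rw [dOptMiddle, show a + t + (b + t) = a + b + 2 * t by ring, eq_div_iff h2, sub_mul,
    div_mul_cancel₀ _ h2]
  ring

lemma dOptMiddle_add {a b t : ℝ} (ha : 0 ≤ a) (hab : a < b) (ht : 0 < t) (h : ℝ) :
    dOptMiddle a b t + h =
      (2 * a * b + (a + b) * t + h * (a + b + 2 * t)) / (a + b + 2 * t) := by
  have h2 : a + b + 2 * t ≠ 0 := by linarith
  rw [dOptMiddle, show a + t + (b + t) = a + b + 2 * t by ring, eq_div_iff h2, add_mul,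
    div_mul_cancel₀ _ h2]
  ring

lemma left_lt_dOptMiddle {a b t : ℝ} (ha : 0 ≤ a) (hab : a < b) (ht : 0 < t) :
    a < dOptMiddle a b t := by
  have hb : 0 < b - a := by linarith
  have hS : 0 < a + b + 2 * t := by linarith
  rw [← sub_pos, dOptMiddle_sub_left ha hab ht]
  positivity

lemma dOptMiddle_lt_right {a b t : ℝ} (ha : 0 ≤ a) (hab : a < b) (ht : 0 < t) :
    dOptMiddle a b t < b := by
  have hb : 0 < b - a := by linarith
  have hb' : 0 < b := by linarith
  have hS : 0 < a + b + 2 * t := by linarith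
  rw [← sub_pos, sub_dOptMiddle ha hab ht]
  positivity

lemma emaxBiasCoeff_pos {a b t σ : ℝ} (ha : 0 ≤ a) (hab : a < b) (ht : 0 < t) (hσ : 0 < σ)
    {θ : Fin 3 → ℝ} (h1 : θ 1 ≠ 0) (h2 : 0 < θ 2) : 0 < emaxBiasCoeff a b t σ θ := by
  have hb : 0 < b := ha.trans_lt hab
  have hab' : a - b ≠ 0 := by linarith
  unfold emaxBiasCoeff
  positivity

/-- Connects the closed form with the expansion: the bracket on the right is minus the inner product
of the coefficients of `L` and `M`. -/
lemma emaxBiasCoeff_eq {a b t σ : ℝ} (ha : 0 ≤ a) (hab : a < b) (ht : 0 < t)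
    {θ : Fin 3 → ℝ} (h1 : θ 1 ≠ 0) (h2 : 0 < θ 2) {m : ℝ} (hm : m = dOptMiddle a b t) :
    emaxBiasCoeff a b t σ θ =
      3 * σ ^ 2 * ((b - m) ^ 2 * (a + θ 2) + (b - a) ^ 2 * (m + θ 2) + (m - a) ^ 2 * (b + θ 2)) /
        (emaxDen a m b fun j => emaxMean (![a, m, b] j) θ) ^ 2 := by
  have hb : 0 < b := ha.trans_lt hab
  have hma := left_lt_dOptMiddle ha hab ht
  rw [emaxDen_emaxMean (by positivity) (by rw [hm]; linarith) (by positivity), hm,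
    dOptMiddle_sub_left ha hab ht, sub_dOptMiddle ha hab ht, dOptMiddle_add ha hab ht]
  have hQ : 2 * a * b + (a + b) * t + θ 2 * (a + b + 2 * t) ≠ 0 := by positivity
  -- The polynomial factor is that bracket times `(a + b + 2 * t) ^ 2 / (b - a) ^ 2`.
  have hbr : 3 * a * b * (a + b) + (a ^ 2 + 10 * a * b + b ^ 2) * t + 3 * (a + b) * t ^ 2 +
        2 * θ 2 * (a ^ 2 + a * b + b ^ 2 + 3 * (a + b) * t + 3 * t ^ 2) =
      (b + t) ^ 2 * (a + θ 2) + (2 * a * b + (a + b) * t + θ 2 * (a + b + 2 * t)) *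
        (a + b + 2 * t) + (a + t) ^ 2 * (b + θ 2) := by ring
  have hS : a + b + 2 * t ≠ 0 := by positivity
  have hba : b - a ≠ 0 := by linarith
  have ht1 : a + t ≠ 0 := by positivity
  have ht2 : b + t ≠ 0 := by positivity
  have ht3 : a + θ 2 ≠ 0 := by positivity
  have ht4 : b + θ 2 ≠ 0 := by positivity
  have h2' := h2.ne'
  rw [emaxBiasCoeff, hbr, show (a - b) ^ 4 = (b - a) ^ 4 by ring]
  -- After `hbr` the identity holds with these factors as independent variables.
  generalize 2 * a * b + (a + b) * t + θ 2 * (a + b + 2 * t) = Q at *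
  generalize a + b + 2 * t = S at *
  generalize b - a = q at *
  generalize a + t = u at *
  generalize b + t = r at *
  generalize a + θ 2 = e at *
  generalize b + θ 2 = f at *
  field_simp

/-! ### Error equation and conclusion. -/

/-- Coefficients of the linear form `emaxNum - h * emaxDen`. -/
def emaxNumCoeff (a m b h : ℝ) : Fin 3 → ℝ :=
  ![(b - m) * (a + h), -((b - a) * (m + h)), (m - a) * (b + h)]

/-- Coefficients of the linear form `emaxDen`. -/
def emaxDenCoeff (a m b : ℝ) : Fin 3 → ℝ :=
  ![-(b - m), b - a, -(m - a)]

lemma sum_emaxDenCoeff (a m b : ℝ) (z : Fin 3 → ℝ) :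
    ∑ j, emaxDenCoeff a m b j * z j = emaxDen a m b z := by
  simp [Fin.sum_univ_three, emaxDenCoeff, emaxDen]
  ring

lemma sum_emaxNumCoeff (a m b h : ℝ) (z : Fin 3 → ℝ) :
    ∑ j, emaxNumCoeff a m b h j * z j = emaxNum a m b z - h * emaxDen a m b z := by
  simp [Fin.sum_univ_three, emaxNumCoeff, emaxDen, emaxNum]
  ring

lemma abs_sum_mul_le {κ : Type*} [Fintype κ] (u z : κ → ℝ) :
    |∑ j, u j * z j| ≤ (∑ j, |u j|) * ∑ j, |z j| := by
  rw [Finset.sum_mul]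
  refine (Finset.abs_sum_le_sum_abs _ _).trans (Finset.sum_le_sum fun j _ => ?_)
  rw [abs_mul]
  gcongr
  exact Finset.single_le_sum (f := fun j => |z j|) (fun j _ => abs_nonneg _) (Finset.mem_univ j)

/-- The error of the nonlinear component of a maximum likelihood estimate solves a linear equation
as soon as the group means of the errors are small. -/
lemma exists_forall_isEmaxMLE_sub_mul_eq {a m b : ℝ} (ha : 0 ≤ a) (ham : a < m) (hmb : m < b)
    {σ : ℝ≥0} (hσ : 0 < σ) {Θ : Set (Fin 3 → ℝ)} (hΘ : ∀ ϑ ∈ Θ, 0 < ϑ 2) {θ : Fin 3 → ℝ}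
    (hθ : θ ∈ interior Θ) (h1 : θ 1 ≠ 0) :
    ∃ δ > 0, ∀ k : ℕ, 0 < k → ∀ (e : Fin 3 × Fin k → ℝ) (z ϑ : Fin 3 → ℝ),
      (∀ j, z j = (∑ l, e (j, l)) / k) → ∑ j, |z j| < δ →
      IsEmaxMLE Θ σ (fun i : Fin 3 × Fin k => ![a, m, b] i.1)
        (fun i => emaxMean (![a, m, b] i.1) θ + e i) ϑ →
      (ϑ 2 - θ 2) * ((emaxDen a m b fun j => emaxMean (![a, m, b] j) θ) +
        ∑ j, emaxDenCoeff a m b j * z j) = ∑ j, emaxNumCoeff a m b (θ 2) j * z j := by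
  have h2 := hΘ θ (interior_subset hθ)
  obtain ⟨δ, hδ, hsolve⟩ := exists_forall_emaxMean_eq_add ha ham hmb hθ h1 h2
  refine ⟨δ, hδ, fun k hk e z ϑ hz hzδ hmle => ?_⟩
  obtain ⟨ϑ', hϑ', hfit⟩ := hsolve z fun j => (Finset.single_le_sum (f := fun j => |z j|)
    (fun j _ => abs_nonneg _) (Finset.mem_univ j)).trans_lt hzδ
  have hϑ := hΘ ϑ hmle.1
  have hfit' : ∀ j, emaxMean (![a, m, b] j) ϑ = emaxMean (![a, m, b] j) θ + z j := by
    intro j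
    rw [hz j]
    exact hmle.emaxMean_eq (x := ![a, m, b]) (μ := fun j => emaxMean (![a, m, b] j) θ) hk hσ hϑ'
      (fun j => by rw [hfit j, hz j]) j
  -- The same elimination at the estimate and at the truth; the difference is the equation for the
  -- error.
  have e1 := mul_emaxDen_eq_emaxNum (a := a) (m := m) (b := b) (by positivity) (by linarith)
    (by linarith) hfit'
  have e2 := mul_emaxDen_eq_emaxNum (a := a) (m := m) (b := b) (ϑ := θ) (by positivity)
    (by linarith) (by linarith) (fun j => rfl)
  rw [emaxDen_add, emaxNum_add] at e1
  rw [sum_emaxDenCoeff, sum_emaxNumCoeff]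
  linear_combination e1 - e2

theorem mainTheorem4 (a b : ℝ) (ha : 0 ≤ a) (hab : a < b)
    -- the guessed value `θ_{2,0}` and the error standard deviation
    (t : ℝ) (ht : 0 < t) (σ : ℝ≥0) (hσ : 0 < σ)
    -- the parameter set; every compact `Θ ⊆ {ϑ | 0 < ϑ 2}` is covered
    (Θ : Set (Fin 3 → ℝ)) (hΘ : IsClosed Θ)
    (c d : ℝ) (hc : 0 < c) (hcd : ∀ ϑ ∈ Θ, ϑ 2 ∈ Set.Icc c d)
    -- the true parameter
    (θ : Fin 3 → ℝ) (hθ : θ ∈ interior Θ) (hθ₁ : θ 1 ≠ 0) :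
    0 < emaxBiasCoeff a b t σ θ ∧
    ∃ C : ℝ, ∀ k : ℕ, 0 < k → ∀ n₁ : ℕ, n₁ = 3 * k →
      ∀ (Ω : Type*) [MeasurableSpace Ω] (P : Measure Ω) [IsProbabilityMeasure P]
        (ε y : Fin 3 × Fin k → Ω → ℝ) (θhat : Ω → Fin 3 → ℝ),
        iIndepFun ε P →
        (∀ i, HasLaw (ε i) (gaussianReal 0 (σ ^ 2)) P) →
        (∀ i ω, y i ω = emaxMean (dOptPoint a b t i.1) θ + ε i ω) →
        AEMeasurable θhat P →
        (∀ᵐ ω ∂P, IsEmaxMLE Θ σ (fun i => dOptPoint a b t i.1) (fun i => y i ω) (θhat ω)) →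
        Integrable (fun ω => θhat ω 2) P ∧
        |(∫ ω, (θhat ω 2 - θ 2) ∂P) - emaxBiasCoeff a b t σ θ / n₁| ≤ C / (n₁ : ℝ) ^ 2 := by
  have hpos : ∀ ϑ ∈ Θ, 0 < ϑ 2 := fun ϑ h => hc.trans_le (hcd ϑ h).1
  have hθΘ := interior_subset hθ
  have hθ₂ := hpos θ hθΘ
  refine ⟨emaxBiasCoeff_pos ha hab ht (by exact_mod_cast hσ) hθ₁ hθ₂, ?_⟩
  obtain ⟨m, hm⟩ : ∃ m, m = dOptMiddle a b t := ⟨_, rfl⟩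
  have hpt : dOptPoint a b t = ![a, m, b] := by rw [hm]; rfl
  have ham : a < m := hm ▸ left_lt_dOptMiddle ha hab ht
  have hmb : m < b := hm ▸ dOptMiddle_lt_right ha hab ht
  rw [emaxBiasCoeff_eq ha hab ht hθ₁ hθ₂ hm, hpt]
  have hD : (emaxDen a m b fun j => emaxMean (![a, m, b] j) θ) ≠ 0 :=
    emaxDen_emaxMean_ne_zero ha ham hmb hθ₁ hθ₂
  obtain ⟨δ, hδ, heq⟩ := exists_forall_isEmaxMLE_sub_mul_eq ha ham hmb hσ hpos hθ hθ₁
  set D := emaxDen a m b fun j => emaxMean (![a, m, b] j) θ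
  set A := (∑ j, |emaxNumCoeff a m b (θ 2) j|) + ∑ j, |emaxDenCoeff a m b j|
  have hN0 : 0 ≤ ∑ j, |emaxNumCoeff a m b (θ 2) j| := Finset.sum_nonneg fun j _ => abs_nonneg _
  have hD0 : 0 ≤ ∑ j, |emaxDenCoeff a m b j| := Finset.sum_nonneg fun j _ => abs_nonneg _
  have hcd' : 0 ≤ d - c := by have := hcd θ hθΘ; linarith [this.1, this.2]
  obtain ⟨C, hC, hTaylor⟩ := exists_forall_abs_sub_le hD (add_nonneg hN0 hD0) hcd' hδ
  -- Three groups give `3 ^ 4`, and `σ ^ 2 / k = 3 * σ ^ 2 / n₁`.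
  refine ⟨C * 3 ^ 4 * (∫ x, x ^ 4 ∂gaussianReal 0 1) * (3 * (σ : ℝ) ^ 2) ^ 2, ?_⟩
  intro k hk n₁ hn Ω _ P _ ε y θhat hind hlaw hy hmeas hmle
  have hk' : (0 : ℝ) < k := by exact_mod_cast hk
  have hmeas2 : AEMeasurable (fun ω => θhat ω 2) P := (measurable_pi_apply 2).comp_aemeasurable hmeas
  have hint : Integrable (fun ω => θhat ω 2) P :=
    Integrable.of_bound hmeas2.aestronglyMeasurable d <| hmle.mono fun ω h => by
      rw [Real.norm_of_nonneg (hpos _ h.1).le]; exact (hcd _ h.1).2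
  refine ⟨hint, ?_⟩
  have hmain := abs_integral_add_le_of_cubic_expansion hk hind hlaw (emaxNumCoeff a m b (θ 2))
    (emaxDenCoeff a m b) D hC (hint.sub (integrable_const (θ 2))) <| by
    filter_upwards [hmle] with ω hω L M hL hM
    set z : Fin 3 → ℝ := fun j => (∑ l, ε (j, l) ω) / k
    have hz0 : 0 ≤ ∑ j, |z j| := Finset.sum_nonneg fun j _ => abs_nonneg _
    refine hTaylor _ L M (∑ j, |z j|) hz0 ?_ ?_ ?_ fun hs => ?_
    · rw [hL]
      exact (abs_sum_mul_le _ z).trans (by gcongr; exact le_add_of_nonneg_right hD0)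
    · rw [hM]
      exact (abs_sum_mul_le _ z).trans (by gcongr; exact le_add_of_nonneg_left hN0)
    · have h1 := hcd _ hω.1
      have h2 := hcd _ hθΘ
      rw [Pi.sub_apply, abs_le]
      constructor <;> linarith [h1.1, h1.2, h2.1, h2.2]
    · rw [hL, hM]
      refine heq k hk (fun i => ε i ω) z (θhat ω) (fun j => rfl) hs ?_
      simpa only [hy, hpt] using hω
  -- `L` and `M` are negatively correlated, so the bias is positive to first order.
  have hsum : ∑ j, emaxNumCoeff a m b (θ 2) j * emaxDenCoeff a m b j =
      -((b - m) ^ 2 * (a + θ 2) + (b - a) ^ 2 * (m + θ 2) + (m - a) ^ 2 * (b + θ 2)) := by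
    simp [Fin.sum_univ_three, emaxNumCoeff, emaxDenCoeff]
    ring
  rw [hsum] at hmain
  simp only [Pi.sub_apply, Fintype.card_fin, NNReal.coe_pow] at hmain
  convert hmain using 1
  · congr 1
    rw [hn]
    push_cast
    field_simp
    ring
  · rw [hn]
    push_cast
    field_simp
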